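/- Let $v_0,v_1,v_2$ be the corners of a nondegenerate triangle in the plane. A coloring of the vertices of a triangulation of it by $\{0,1,2\}$ is a Sperner coloring if every vertex $x$ has a color $i$ such that $v_i$ is a vertex of the smallest face of the triangle that contains $x$ (in particular $v_i$ has color $i$). Consider the following communication problem for three players in the broadcast model, in which, one bit at a time, a player determined by the bits sent so far broadcasts a bit depending on its own input and on the bits sent so far, and the output is determined by the sequence of broadcast bits. Publicly known are $n$ and a triangulation with exactly $n$ vertices, labeled by $[n]$, of a triangle. For $i\in\{1,2,3\}$ player $i$ gets a set $C_{i-1}\subseteq[n]$, intended to be the class of color $i-1$ of a Sperner coloring. On every input $(C_0,C_1,C_2)$ the players have to output one of the following: (a) a triple $(x_0,x_1,x_2)\in C_0\times C_1\times C_2$ whose entries are the three distinct vertices of a triangle of the triangulation; (b) a vertex that does not belong to exactly one of $C_0,C_1,C_2$, which shows that these sets are not mutually disjoint and exhaustive; (c) a vertex $x\in C_i$, for some $i$, such that $v_i$ is not a vertex of the smallest face of the triangle containing $x$, which shows that the boundary condition of a Sperner coloring is violated (so if the sets satisfy this boundary condition, the output is (a) or (b), and if they are the classes of a Sperner coloring,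 it is (a)). Then there is a deterministic protocol for this problem that uses $O(\log^2 n)$ bits of communication in the worst case, where the implied constant is absolute (independent of $n$ and of the triangulation). -/

import Mathlib

namespace BroadcastSperner

/-- The Euclidean plane. -/
abbrev Plane : Type := EuclideanSpace ℝ (Fin 2)

/-- A deterministic protocol in the broadcast (shared blackboard, number-in-hand) model, as a
protocol tree.  The players are the elements of `ι`, player `p` holds an input in `X p`, and `Z` is
the set of outputs.  At a node the player `speaker` broadcasts one bit `bit x`, which depends only
on the own input `x` of that player and, through the position of the node in the tree, on the bits
broadcast before; every player sees it.  A leaf carries the output, which is therefore determined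
by the transcript and known to every player. -/
inductive Protocol {ι : Type} (X : ι → Type) (Z : Type) : Type where
  | output (z : Z) : Protocol X Z
  | speak (speaker : ι) (bit : X speaker → Bool) (next₀ next₁ : Protocol X Z) : Protocol X Z

namespace Protocol

variable {ι : Type} {X : ι → Type} {Z : Type}

/-- The output of a protocol on the inputs `x p` of the players `p`. -/
def run : Protocol X Z → (∀ p, X p) → Z
  | output z, _ => z
  | speak p bit next₀ next₁, x => if bit (x p) then next₁.run x else next₀.run x

/-- The number of bits communicated in the worst case: the depth of the protocol tree. -/
def cost : Protocol X Z → ℕ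
  | output _ => 0
  | speak _ _ next₀ next₁ => 1 + max next₀.cost next₁.cost

end Protocol

/-- A triangulation with `n` vertices of a nondegenerate triangle in the plane, the vertices of
the triangulation being labeled by `Fin n`. -/
structure Triangulation (n : ℕ) where
  /-- the corners `v₀, v₁, v₂` of the triangle -/
  corner : Fin 3 → Plane
  corner_indep : AffineIndependent ℝ corner
  /-- the simplicial complex of all vertices, edges and small triangles -/
  complex : Geometry.SimplicialComplex ℝ Plane
  space_eq : complex.space = convexHull ℝ (Set.range corner)
  /-- the vertex with a given label -/
  point : Fin n → Plane
  point_injective : Function.Injective point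
  range_point : Set.range point = complex.vertices

namespace Triangulation

variable {n : ℕ} (T : Triangulation n)

/-- The (indices of the) corners that span the smallest face of the big triangle containing the
vertex labeled `k`. -/
def carrier (k : Fin n) : Set (Fin 3) :=
  {i | ∀ I : Set (Fin 3), T.point k ∈ convexHull ℝ (T.corner '' I) → i ∈ I}

/-- The vertices labeled `x 0`, `x 1`, `x 2` are the three distinct vertices of a triangle of the
triangulation. -/
def IsTriangle (x : Fin 3 → Fin n) : Prop :=
  Function.Injective x ∧ Finset.univ.image (T.point ∘ x) ∈ T.complex.faces

end Triangulation

/-- The possible outputs of the players. -/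
inductive Answer (n : ℕ) : Type where
  | panchromatic (x : Fin 3 → Fin n) : Answer n
  | notPartition (k : Fin n) : Answer n
  | notSperner (k : Fin n) : Answer n

/-- Correctness of an answer when the color classes held by the players are `C 0`, `C 1`, `C 2`.

* `panchromatic x`: `x ∈ C 0 × C 1 × C 2` is a triangle of the triangulation.
* `notPartition k`: the vertex `k` lies in no class or in at least two of them, so the classes are
  not mutually disjoint and exhaustive.
* `notSperner k`: the vertex `k` has a color that is not a color of the smallest face containing it,
  so the classes violate the boundary condition of a Sperner coloring.  (For the corner `i` this
  says that it has a color other than `i`.) If the classes satisfy the boundary condition, this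
  answer is never correct. -/
def Answer.IsCorrect {n : ℕ} (T : Triangulation n) (C : Fin 3 → Finset (Fin n)) :
    Answer n → Prop
  | .panchromatic x => (∀ i, x i ∈ C i) ∧ T.IsTriangle x
  | .notPartition k => ¬ ∃! i, k ∈ C i
  | .notSperner k => ∃ i, k ∈ C i ∧ i ∉ T.carrier k

end BroadcastSperner

namespace BroadcastSperner

open Filter Topology

/-! ### Local structure of finite simplicial complexes. -/

section Geometry

variable {E : Type*} [NormedAddCommGroup E] [NormedSpace ℝ E]

/-! Player 0 alone knows the doors of `A = C 0`, that is, the edges with exactly one end in `A`.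
Suppose that `A` contains the corner `v₀` and no vertex of the opposite side. A triangle with a door
has exactly two of them, and an edge lies in two triangles, or in one if it is on the boundary
(`natCast_card_tri`). The side opposite to `v₂` has an odd number of doors
(`natCast_card_door_side`) and the side opposite to `v₀` has none. So, by parity, some door opposite
to `v₂` is linked through triangles to a door opposite to `v₁` (`exists_reachable_door`). Player 0
fixes a chain of fewer than `n²` doors realizing this (`exists_chain`).

Look at the ends of these doors outside `A`. In a Sperner coloring the first has color 1 and the
last has color 2, because of the sides on which they lie. Binary search finds consecutive doors
whose outer ends have colors 1 and 2; these doors lie in one triangle, which is panchromatic. Each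
of the `O(log n)` rounds costs `O(log n)` bits to name an outer end and two bits to learn its color.
Any departure from the promise surfaces at a queried vertex or in player 0's initial tests, and
yields a certificate.

The geometric input is that every edge has exactly one triangle on each side to which the big
triangle extends, and that the vertices on a side of the big triangle form a path. -/

theorem affineMap_apply_sum (ℓ : E →ᵃ[ℝ] ℝ) {s : Finset E} {w : E → ℝ}
    (hw : ∑ y ∈ s, w y = 1) : ℓ (∑ y ∈ s, w y • y) = ∑ y ∈ s, w y * ℓ y := by
  have h : ∀ x, ℓ x = ℓ.linear x + ℓ 0 := fun x ↦ congrFun ℓ.decomp x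
  simp only [h (∑ y ∈ s, w y • y), map_sum, map_smul, smul_eq_mul]
  calc ∑ y ∈ s, w y * ℓ.linear y + ℓ 0
      = ∑ y ∈ s, w y * ℓ.linear y + ∑ y ∈ s, w y * ℓ 0 := by rw [← Finset.sum_mul, hw, one_mul]
    _ = ∑ y ∈ s, w y * ℓ y := by
      rw [← Finset.sum_add_distrib]
      exact Finset.sum_congr rfl fun y _ ↦ by rw [h y]; ring

theorem affineIndependent_of_mem_finset {ι : Type*} {s : Finset E} {p : ι → E}
    (hs : AffineIndependent ℝ ((↑) : s → E)) (hp : ∀ i, p i ∈ s) (hinj : Function.Injective p) :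
    AffineIndependent ℝ p := by
  have hinj' : Function.Injective fun i ↦ (⟨p i, hp i⟩ : s) := fun _ _ hij ↦
    hinj (congrArg Subtype.val hij)
  exact hs.comp_embedding ⟨_, hinj'⟩

/-- If a point of a convex hull lies in the supporting hyperplane `κ = 0` and satisfies `ℓ > 0`,
then so does one of the vertices. -/
theorem exists_mem_of_mem_convexHull {s : Finset E} {q : E}
    (hq : q ∈ convexHull ℝ (s : Set E)) (κ ℓ : E →ᵃ[ℝ] ℝ) (hκ : ∀ y ∈ s, 0 ≤ κ y)
    (hκq : κ q = 0) (hℓ : 0 < ℓ q) : ∃ y ∈ s, κ y = 0 ∧ 0 < ℓ y := by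
  obtain ⟨w, hw, hw1, rfl⟩ := Finset.mem_convexHull'.1 hq
  rw [affineMap_apply_sum κ hw1] at hκq
  rw [affineMap_apply_sum ℓ hw1] at hℓ
  have h0 := (Finset.sum_eq_zero_iff_of_nonneg
    fun y hy ↦ mul_nonneg (hw y hy) (hκ y hy)).1 hκq
  obtain ⟨y, hy, hpos⟩ := Finset.exists_lt_of_sum_lt (by simpa using hℓ :
    ∑ y ∈ s, (0 : ℝ) < ∑ y ∈ s, w y * ℓ y)
  have hwy : 0 < w y := (hw y hy).lt_of_ne fun h ↦ by simp [← h] at hpos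
  exact ⟨y, hy, (mul_eq_zero.1 (h0 y hy)).resolve_left hwy.ne', pos_of_mul_pos_right hpos hwy.le⟩

variable (K : Geometry.SimplicialComplex ℝ E)

/-- A segment that starts at `m` inside the space of a finite complex begins in a face that
contains `m`. -/
theorem exists_face_mem_lineMap (hK : K.faces.Finite) {m p : E}
    (hp : ∀ᶠ ε : ℝ in 𝓝[>] 0, AffineMap.lineMap m p ε ∈ K.space) :
    ∃ s ∈ K.faces, m ∈ convexHull ℝ (s : Set E) ∧
      ∃ ε : ℝ, 0 < ε ∧ AffineMap.lineMap m p ε ∈ convexHull ℝ (s : Set E) := by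
  -- Hulls of faces are closed and finitely many, so near `m` the segment avoids every face that
  -- misses `m`.
  have hev : ∀ s ∈ {s ∈ K.faces | m ∉ convexHull ℝ (s : Set E)},
      ∀ᶠ ε : ℝ in 𝓝[>] 0, AffineMap.lineMap m p ε ∉ convexHull ℝ (s : Set E) := by
    intro s hs
    have hc : IsClosed (convexHull ℝ (s : Set E)) := s.finite_toSet.isClosed_convexHull ℝ
    have ht : Tendsto (fun ε : ℝ ↦ AffineMap.lineMap m p ε) (𝓝[>] 0) (𝓝 m) := by
      have : Continuous fun ε : ℝ ↦ AffineMap.lineMap m p ε := AffineMap.lineMap_continuous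
      simpa using (this.tendsto 0).mono_left nhdsWithin_le_nhds
    exact ht.eventually (hc.isOpen_compl.mem_nhds hs.2)
  have hall := (hK.subset (Set.sep_subset _ _)).eventually_all (l := 𝓝[>] (0 : ℝ)) |>.2 hev
  obtain ⟨ε, hε, h1, h2⟩ := ((eventually_mem_nhdsWithin (a := (0 : ℝ)) (s := Set.Ioi 0)).and
    (hp.and hall)).exists
  obtain ⟨s, hs, hs'⟩ := Geometry.SimplicialComplex.mem_space_iff.1 h1
  refine ⟨s, hs, ?_, ε, hε, hs'⟩
  by_contra hm
  exact h2 s ⟨hs, hm⟩ hs'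

variable [DecidableEq E]

/-- A face `e` of a finite complex extends to a face with one more vertex on the side
`ℓ > 0`, provided that the space contains points near a point `m` of `e` on this side. The new
vertex can be taken in a supporting hyperplane `κ = 0`. -/
theorem exists_insert_mem_faces (hK : K.faces.Finite) {e : Finset E} {m p : E}
    (he : ∀ s ∈ K.faces, m ∈ convexHull ℝ (s : Set E) → e ⊆ s)
    (hp : ∀ᶠ ε : ℝ in 𝓝[>] 0, AffineMap.lineMap m p ε ∈ K.space)
    (κ ℓ : E →ᵃ[ℝ] ℝ) (hκ : ∀ y ∈ K.vertices, 0 ≤ κ y) (hκm : κ m = 0) (hκp : κ p = 0)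
    (hℓm : ℓ m = 0) (hℓp : 0 < ℓ p) :
    ∃ c, insert c e ∈ K.faces ∧ κ c = 0 ∧ 0 < ℓ c := by
  obtain ⟨s, hs, hm, ε, hε, hq⟩ := exists_face_mem_lineMap K hK hp
  have hv : ∀ y ∈ s, y ∈ K.vertices := fun y hy ↦
    K.down_closed hs (Finset.singleton_subset_iff.2 hy) (Finset.singleton_nonempty y)
  obtain ⟨c, hc, h1, h2⟩ := exists_mem_of_mem_convexHull hq κ ℓ (fun y hy ↦ hκ y (hv y hy))
    (by rw [AffineMap.apply_lineMap, hκm, hκp]; simp)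
    (by rw [AffineMap.apply_lineMap, hℓm]; simp [AffineMap.lineMap_apply, hε, hℓp])
  exact ⟨c, K.down_closed hs (Finset.insert_subset hc (he s hs hm)) (Finset.insert_nonempty c e),
    h1, h2⟩

/-- Two faces meet in the hull of their common vertices; for `c ≠ c'` these all lie in `e`. -/
theorem eq_of_insert_mem_faces {e : Finset E} {c c' q : E} (hc : insert c e ∈ K.faces)
    (hc' : insert c' e ∈ K.faces) (hq : q ∈ convexHull ℝ (insert c e : Finset E))
    (hq' : q ∈ convexHull ℝ (insert c' e : Finset E))
    (hqe : q ∉ convexHull ℝ (e : Set E)) : c = c' := by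
  by_contra hne
  refine hqe (convexHull_mono ?_ (K.inter_subset_convexHull hc hc' ⟨hq, hq'⟩))
  intro y
  simp only [Finset.coe_insert, Set.mem_inter_iff, Set.mem_insert_iff, Finset.mem_coe]
  rintro ⟨rfl | h, rfl | h'⟩ <;> first | assumption | exact absurd rfl hne

/-- If an end of the edge were missing from `s`, the edge and `s` would share at most one vertex,
and the midpoint would have to be that vertex. -/
theorem subset_of_midpoint_mem_convexHull {a b : E} (hab : a ≠ b) (he : {a, b} ∈ K.faces)
    {s : Finset E} (hs : s ∈ K.faces) (hm : midpoint ℝ a b ∈ convexHull ℝ (s : Set E)) :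
    {a, b} ⊆ s := by
  have hm' : midpoint ℝ a b ∈ convexHull ℝ (({a, b} : Finset E) : Set E) := by
    simpa [convexHull_pair] using midpoint_mem_segment a b
  have h := K.inter_subset_convexHull he hs ⟨hm', hm⟩
  have key : ∀ x y : E, x ≠ y → (({x, y} : Set E) ∩ s) ⊆ {y} →
      midpoint ℝ x y ∉ convexHull ℝ (({x, y} : Set E) ∩ s) := by
    intro x y hxy hsub hmem
    have := convexHull_mono hsub hmem
    rw [convexHull_singleton, Set.mem_singleton_iff, midpoint_eq_right_iff] at this
    exact hxy this
  rw [Finset.coe_pair] at h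
  rw [Finset.insert_subset_iff, Finset.singleton_subset_iff]
  constructor
  · by_contra ha
    refine key a b hab ?_ h
    rintro z ⟨rfl | rfl, hz⟩
    · exact absurd hz ha
    · rfl
  · by_contra hb
    rw [midpoint_comm, Set.pair_comm] at h
    refine key b a hab.symm ?_ h
    rintro z ⟨rfl | rfl, hz⟩
    · exact absurd hz hb
    · rfl

end Geometry

/-- The vertices of a triangle of a complex in the plane, as an affine basis. -/
theorem exists_affineBasis_of_mem_faces {K : Geometry.SimplicialComplex ℝ Plane} {a b c : Plane}
    (h : {a, b, c} ∈ K.faces) (hab : a ≠ b) (hac : a ≠ c) (hbc : b ≠ c) :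
    ∃ B : AffineBasis (Fin 3) ℝ Plane, B 0 = a ∧ B 1 = b ∧ B 2 = c := by
  have hind := K.indep h
  have hmem : ∀ i, (![a, b, c] : Fin 3 → Plane) i ∈ ({a, b, c} : Finset Plane) := by
    intro i; fin_cases i <;> simp
  have hinj : Function.Injective (![a, b, c] : Fin 3 → Plane) := by
    intro i j hij
    fin_cases i <;> fin_cases j <;> simp_all
  have hi := affineIndependent_of_mem_finset hind hmem hinj
  have htop : affineSpan ℝ (Set.range ![a, b, c]) = ⊤ :=
    hi.affineSpan_eq_top_iff_card_eq_finrank_add_one.2 (by simp)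
  exact ⟨⟨![a, b, c], hi, htop⟩, rfl, rfl, rfl⟩

/-- Three vertices of a triangle are not contained in a line. -/
theorem ne_zero_of_mem_faces {K : Geometry.SimplicialComplex ℝ Plane} {a b c : Plane}
    (h : {a, b, c} ∈ K.faces) (hab : a ≠ b) (hac : a ≠ c) (hbc : b ≠ c) (ℓ : Plane →ᵃ[ℝ] ℝ)
    (ha : ℓ a = 0) (hb : ℓ b = 0) {p : Plane} (hp : ℓ p ≠ 0) : ℓ c ≠ 0 := by
  intro hc
  obtain ⟨B, rfl, rfl, rfl⟩ := exists_affineBasis_of_mem_faces h hab hac hbc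
  apply hp
  have : ℓ = AffineMap.const ℝ Plane 0 := by
    apply AffineMap.ext_on B.tot
    rintro _ ⟨i, rfl⟩
    fin_cases i <;> simp [ha, hb, hc]
  simp [this]

/-- An edge is contained in at most one triangle on each side. -/
theorem eq_of_same_side {K : Geometry.SimplicialComplex ℝ Plane} {a b c c' : Plane}
    (h : {a, b, c} ∈ K.faces) (h' : {a, b, c'} ∈ K.faces) (hab : a ≠ b) (ℓ : Plane →ᵃ[ℝ] ℝ)
    (ha : ℓ a = 0) (hb : ℓ b = 0) (hc : 0 < ℓ c) (hc' : 0 < ℓ c') : c = c' := by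
  have hac : a ≠ c := by rintro rfl; exact hc.ne' ha
  have hbc : b ≠ c := by rintro rfl; exact hc.ne' hb
  obtain ⟨B, rfl, rfl, rfl⟩ := exists_affineBasis_of_mem_faces h hab hac hbc
  set α := B.coord 0 c' with hα
  set β := B.coord 1 c' with hβ
  set γ := B.coord 2 c' with hγ
  have hsum : α + β + γ = 1 := by
    rw [hα, hβ, hγ, ← Fin.sum_univ_three fun i ↦ B.coord i c', B.sum_coord_apply_eq_one]
  have hcomb : c' = α • B 0 + β • B 1 + γ • B 2 := by
    rw [hα, hβ, hγ, ← Fin.sum_univ_three fun i ↦ B.coord i c' • B i,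
      B.linear_combination_coord_eq_self]
  have hdec : ∀ x, ℓ x = ℓ.linear x + ℓ 0 := fun x ↦ congrFun ℓ.decomp x
  have hγpos : 0 < γ := by
    have h1 : ℓ c' = γ * ℓ (B 2) := by
      have e0 := hdec (B 0)
      have e1 := hdec (B 1)
      have e2 := hdec (B 2)
      rw [hdec c', hcomb]
      simp only [map_add, map_smul, smul_eq_mul]
      linear_combination (-α) * e0 - β * e1 - γ * e2 + α * ha + β * hb - (ℓ 0) * hsum
    rw [h1] at hc'
    exact pos_of_mul_pos_left hc' hc.le
  -- With this choice `(1 - ε) / 2 = ε * (|α| + |β|)`, so the point `q` below, close to the midpoint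
  -- of the edge, has nonnegative coordinates in both triangles.
  set ε : ℝ := 1 / (1 + 2 * |α| + 2 * |β|) with hε
  have hden : 0 < 1 + 2 * |α| + 2 * |β| := by positivity
  have hεpos : 0 < ε := by positivity
  have hε1 : ε * (1 + 2 * |α| + 2 * |β|) = 1 := by rw [hε]; field_simp
  have hεα : -(ε * |α|) ≤ ε * α := by nlinarith [neg_abs_le α]
  have hεβ : -(ε * |β|) ≤ ε * β := by nlinarith [neg_abs_le β]
  have p1 : 0 ≤ ε * |α| := by positivity
  have p2 : 0 ≤ ε * |β| := by positivity
  have hεle : ε ≤ 1 := by nlinarith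
  have mem3 : ∀ (x y z : Plane) (u v w : ℝ), 0 ≤ u → 0 ≤ v → 0 ≤ w → u + v + w = 1 →
      u • x + v • y + w • z ∈ convexHull ℝ (insert z {x, y} : Finset Plane) := by
    intro x y z u v w hu hv hw huvw
    have hconv := convex_convexHull ℝ (((insert z {x, y} : Finset Plane)) : Set Plane)
    have hsub := subset_convexHull ℝ (((insert z {x, y} : Finset Plane)) : Set Plane)
    have := hconv.sum_mem (t := Finset.univ) (w := ![u, v, w]) (z := ![x, y, z])
      (by intro i _; fin_cases i <;> simp [hu, hv, hw])
      (by simp [Fin.sum_univ_three, huvw])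
      (by intro i _; fin_cases i <;> exact hsub (by simp))
    simpa [Fin.sum_univ_three] using this
  have perm : ∀ z : Plane, ({B 0, B 1, z} : Finset Plane) = insert z {B 0, B 1} := by
    intro z; ext y; simp only [Finset.mem_insert, Finset.mem_singleton]; tauto
  have hq : ((1 - ε) / 2) • B 0 + ((1 - ε) / 2) • B 1 + ε • c' =
      ((1 - ε) / 2 + ε * α) • B 0 + ((1 - ε) / 2 + ε * β) • B 1 + (ε * γ) • B 2 := by
    rw [hcomb]; module
  refine eq_of_insert_mem_faces K (e := {B 0, B 1}) (perm _ ▸ h) (perm _ ▸ h')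
    (q := ((1 - ε) / 2) • B 0 + ((1 - ε) / 2) • B 1 + ε • c') ?_ ?_ ?_
  · rw [hq]
    refine mem3 _ _ _ _ _ _ ?_ ?_ (by positivity) ?_
    · nlinarith
    · nlinarith
    · linear_combination ε * hsum
  · exact mem3 _ _ _ _ _ _ (by linarith) (by linarith) hεpos.le (by ring)
  -- `ℓ` vanishes on the edge but equals `ε * ℓ c' > 0` at `q`.
  · intro hmem
    have hpos : 0 < ℓ (((1 - ε) / 2) • B 0 + ((1 - ε) / 2) • B 1 + ε • c') := by
      have e0 := hdec (B 0)
      have e1 := hdec (B 1)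
      have e2 := hdec c'
      have : ℓ (((1 - ε) / 2) • B 0 + ((1 - ε) / 2) • B 1 + ε • c') = ε * ℓ c' := by
        rw [hdec]
        simp only [map_add, map_smul, smul_eq_mul]
        linear_combination (-(1 - ε) / 2) * e0 + (-(1 - ε) / 2) * e1 - ε * e2 +
          ((1 - ε) / 2) * ha + ((1 - ε) / 2) * hb
      rw [this]; positivity
    obtain ⟨y, hy, -, hy'⟩ := exists_mem_of_mem_convexHull hmem (AffineMap.const ℝ Plane 0) ℓ
      (by simp) (by simp) hpos
    simp only [Finset.mem_insert, Finset.mem_singleton] at hy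
    rcases hy with rfl | rfl <;> linarith

end BroadcastSperner

/-! ### Incidences of vertices, edges and triangles in a triangulation of the triangle. -/

namespace BroadcastSperner

open Filter Topology

theorem exists_affineMap_vanishing {a b : Plane} (hab : a ≠ b) :
    ∃ ℓ : Plane →ᵃ[ℝ] ℝ, ℓ a = 0 ∧ ℓ b = 0 ∧ ∃ p, 0 < ℓ p := by
  set d : Plane := b - a with hd
  have hd0 : d ≠ 0 := sub_ne_zero.2 hab.symm
  let f : Plane →ₗ[ℝ] ℝ := ((d 0) • EuclideanSpace.proj (𝕜 := ℝ) (1 : Fin 2) -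
    (d 1) • EuclideanSpace.proj (𝕜 := ℝ) (0 : Fin 2) : Plane →L[ℝ] ℝ).toLinearMap
  have hf : ∀ v, f v = d 0 * v 1 - d 1 * v 0 := fun v ↦ by simp [f]
  refine ⟨f.toAffineMap - AffineMap.const ℝ Plane (f a), by simp, ?_, a + !₂[-d 1, d 0], ?_⟩
  · have : f b - f a = 0 := by rw [← map_sub, ← hd, hf]; ring
    simpa using this
  · have h : f !₂[-d 1, d 0] = d 0 ^ 2 + d 1 ^ 2 := by rw [hf]; simp; ring
    have hpos : 0 < d 0 ^ 2 + d 1 ^ 2 := by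
      by_contra hcon
      have h0 : d 0 = 0 := by nlinarith [sq_nonneg (d 0), sq_nonneg (d 1)]
      have h1 : d 1 = 0 := by nlinarith [sq_nonneg (d 0), sq_nonneg (d 1)]
      exact hd0 (by ext i; fin_cases i <;> simp [h0, h1])
    have : f (a + !₂[-d 1, d 0]) - f a = d 0 ^ 2 + d 1 ^ 2 := by rw [map_add, h]; ring
    rw [← this] at hpos
    simpa using hpos

namespace Triangulation

variable {n : ℕ} (T : Triangulation n)

/-- The corners of the big triangle as an affine basis of the plane. -/
noncomputable def basis : AffineBasis (Fin 3) ℝ Plane :=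
  ⟨T.corner, T.corner_indep,
    T.corner_indep.affineSpan_eq_top_iff_card_eq_finrank_add_one.2 (by simp)⟩

theorem coe_basis : ⇑T.basis = T.corner := rfl

/-- The barycentric coordinates of a vertex with respect to the corners. -/
noncomputable def bary (i : Fin 3) (k : Fin n) : ℝ := T.basis.coord i (T.point k)

theorem mem_space_iff {x : Plane} : x ∈ T.complex.space ↔ ∀ i, 0 ≤ T.basis.coord i x := by
  rw [T.space_eq, ← T.coe_basis, T.basis.convexHull_eq_nonneg_coord]
  rfl

theorem point_mem_vertices (k : Fin n) : T.point k ∈ T.complex.vertices :=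
  T.range_point ▸ Set.mem_range_self k

theorem exists_point_eq {y : Plane} (hy : y ∈ T.complex.vertices) : ∃ k, T.point k = y := by
  rwa [← T.range_point] at hy

theorem mem_vertices_of_mem {s : Finset Plane} (hs : s ∈ T.complex.faces) {y : Plane}
    (hy : y ∈ s) : y ∈ T.complex.vertices :=
  T.complex.down_closed hs (Finset.singleton_subset_iff.2 hy) (Finset.singleton_nonempty y)

theorem coord_nonneg {y : Plane} (hy : y ∈ T.complex.vertices) (i : Fin 3) :
    0 ≤ T.basis.coord i y :=
  T.mem_space_iff.1 (Geometry.SimplicialComplex.vertices_subset_space hy) i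

theorem bary_nonneg (i : Fin 3) (k : Fin n) : 0 ≤ T.bary i k :=
  T.coord_nonneg (T.point_mem_vertices k) i

theorem bary_sum (k : Fin n) : T.bary 0 k + T.bary 1 k + T.bary 2 k = 1 := by
  rw [← T.basis.sum_coord_apply_eq_one (T.point k), Fin.sum_univ_three]
  rfl

theorem bary_add_le (k : Fin n) {i j : Fin 3} (hij : i ≠ j) : T.bary i k + T.bary j k ≤ 1 := by
  have h0 := T.bary_nonneg 0 k
  have h1 := T.bary_nonneg 1 k
  have h2 := T.bary_nonneg 2 k
  have hs := T.bary_sum k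
  fin_cases i <;> fin_cases j <;> first | exact absurd rfl hij | skip
  all_goals simp only [Fin.reduceFinMk, Fin.zero_eta, Fin.mk_one, Fin.isValue]; linarith

theorem eq_of_coord_eq {x y : Plane} {i j : Fin 3} (hij : i ≠ j)
    (hi : T.basis.coord i x = T.basis.coord i y) (hj : T.basis.coord j x = T.basis.coord j y) :
    x = y := by
  apply T.basis.ext_elem
  have hx := T.basis.sum_coord_apply_eq_one x
  have hy := T.basis.sum_coord_apply_eq_one y
  rw [Fin.sum_univ_three] at hx hy
  intro l
  fin_cases i <;> fin_cases j <;> first | exact absurd rfl hij | skip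
  all_goals
    simp only [Fin.reduceFinMk, Fin.zero_eta, Fin.mk_one, Fin.isValue] at hi hj
    fin_cases l <;> simp only [Fin.reduceFinMk, Fin.zero_eta, Fin.mk_one, Fin.isValue] <;> linarith

theorem finite_faces : T.complex.faces.Finite := by
  have hfin : T.complex.vertices.Finite := T.range_point ▸ Set.finite_range T.point
  refine (hfin.toFinset.powerset.finite_toSet).subset fun s hs ↦ ?_
  simp only [Finset.coe_powerset, Set.mem_preimage, Set.mem_powerset_iff]
  intro y hy
  simpa using T.mem_vertices_of_mem hs hy

theorem exists_corner (i : Fin 3) : ∃ k, T.point k = T.corner i := by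
  have hmem : T.corner i ∈ T.complex.space := by
    rw [T.space_eq]
    exact subset_convexHull ℝ _ (Set.mem_range_self i)
  obtain ⟨s, hs, hq⟩ := Geometry.SimplicialComplex.mem_space_iff.1 hmem
  have hsum : ∀ x, T.basis.coord 0 x + T.basis.coord 1 x + T.basis.coord 2 x = 1 := fun x ↦ by
    rw [← T.basis.sum_coord_apply_eq_one x, Fin.sum_univ_three]
  have hle : ∀ y ∈ s, T.basis.coord i y ≤ 1 := fun y hy ↦ by
    have h := T.coord_nonneg (T.mem_vertices_of_mem hs hy)
    have := hsum y
    have h0 := h 0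
    have h1 := h 1
    have h2 := h 2
    fin_cases i <;> simp only [Fin.reduceFinMk, Fin.zero_eta, Fin.mk_one, Fin.isValue] <;> linarith
  have hi : T.basis.coord i (T.corner i) = 1 := T.basis.coord_apply_eq i
  -- The supporting line `coord i = 1` touches the big triangle only at the corner `i`, so a face
  -- containing the corner has it as a vertex.
  obtain ⟨y, hy, h, -⟩ := exists_mem_of_mem_convexHull hq
    (AffineMap.const ℝ Plane 1 - T.basis.coord i) (AffineMap.const ℝ Plane 1)
    (fun y hy ↦ by simpa using hle y hy) (by simp [hi]) (by simp)
  have hy1 : T.basis.coord i y = 1 := by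
    simp only [AffineMap.coe_sub, AffineMap.coe_const, Pi.sub_apply, Function.const_apply] at h
    linarith
  obtain ⟨k, rfl⟩ := T.exists_point_eq (T.mem_vertices_of_mem hs hy)
  refine ⟨k, T.basis.ext_elem fun j ↦ ?_⟩
  rcases eq_or_ne i j with rfl | hij
  · rw [hy1, hi]
  · have h1 : T.basis.coord j (T.corner i) = 0 := T.basis.coord_apply_ne hij.symm
    have h2 : T.bary i k + T.bary j k ≤ 1 := T.bary_add_le k hij
    have h3 : T.bary i k = 1 := hy1
    have h4 := T.bary_nonneg j k
    rw [h1]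
    change T.bary j k = 0
    linarith

/-- Such a point is a convex combination of the other two corners. -/
theorem notMem_carrier {i : Fin 3} {k : Fin n} (h : T.bary i k = 0) : i ∉ T.carrier k := by
  intro hc
  refine hc {j | j ≠ i} ?_ rfl
  have hi : T.basis.coord i (T.point k) = 0 := h
  rw [← T.basis.linear_combination_coord_eq_self (T.point k),
    ← Finset.sum_erase Finset.univ (a := i) (by rw [hi, zero_smul])]
  refine (convex_convexHull ℝ _).sum_mem (fun j _ ↦ T.bary_nonneg j k) ?_ fun j hj ↦ ?_
  · rw [Finset.sum_erase (f := fun j ↦ T.basis.coord j (T.point k)) _ hi, T.basis.sum_coord_apply_eq_one]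
  · exact subset_convexHull ℝ _ ⟨j, Finset.ne_of_mem_erase hj, rfl⟩

/-- The vertices `a` and `b` are distinct and joined by an edge. -/
def Edge (a b : Fin n) : Prop := a ≠ b ∧ {T.point a, T.point b} ∈ T.complex.faces

/-- The vertices `a`, `b`, `c` are the three distinct vertices of a small triangle. -/
def Tri (a b c : Fin n) : Prop :=
  a ≠ b ∧ a ≠ c ∧ b ≠ c ∧ {T.point a, T.point b, T.point c} ∈ T.complex.faces

variable {T}

theorem Edge.symm {a b : Fin n} (h : T.Edge a b) : T.Edge b a :=
  ⟨h.1.symm, Finset.pair_comm (T.point a) (T.point b) ▸ h.2⟩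

theorem Tri.swap_right {a b c : Fin n} (h : T.Tri a b c) : T.Tri a c b := by
  refine ⟨h.2.1, h.1, h.2.2.1.symm, ?_⟩
  rw [Finset.pair_comm]
  exact h.2.2.2

theorem Tri.swap_left {a b c : Fin n} (h : T.Tri a b c) : T.Tri b a c := by
  refine ⟨h.1.symm, h.2.2.1, h.2.1, ?_⟩
  rw [Finset.insert_comm]
  exact h.2.2.2

theorem Tri.edge {a b c : Fin n} (h : T.Tri a b c) : T.Edge a b :=
  ⟨h.1, T.complex.down_closed h.2.2.2 (by
    intro x; simp only [Finset.mem_insert, Finset.mem_singleton]; tauto) (Finset.insert_nonempty _ _)⟩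

variable (T)

theorem eventually_lineMap_mem_of_mem {m p : Plane} (hm : m ∈ T.complex.space)
    (hp : p ∈ T.complex.space) :
    ∀ᶠ ε : ℝ in 𝓝[>] 0, AffineMap.lineMap m p ε ∈ T.complex.space := by
  have hconv : Convex ℝ T.complex.space := T.space_eq ▸ convex_convexHull ℝ _
  filter_upwards [Ioo_mem_nhdsGT (zero_lt_one' ℝ)] with ε hε
  exact hconv.lineMap_mem hm hp ⟨hε.1.le, hε.2.le⟩

theorem eventually_lineMap_mem_of_pos {m : Plane} (hm : ∀ i, 0 < T.basis.coord i m) (p : Plane) :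
    ∀ᶠ ε : ℝ in 𝓝[>] 0, AffineMap.lineMap m p ε ∈ T.complex.space := by
  simp only [T.mem_space_iff]
  rw [eventually_all]
  intro i
  simp only [AffineMap.apply_lineMap]
  have hc : Continuous fun ε : ℝ ↦ AffineMap.lineMap (T.basis.coord i m) (T.basis.coord i p) ε :=
    AffineMap.lineMap_continuous
  have ht := (hc.tendsto 0).mono_left (nhdsWithin_le_nhds (s := Set.Ioi 0))
  rw [AffineMap.lineMap_apply_zero] at ht
  filter_upwards [ht.eventually (lt_mem_nhds (hm i))] with ε hε using hε.le

/-- An edge has exactly one triangle on each side that the big triangle extends to. -/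
theorem existsUnique_tri {a b : Fin n} (h : T.Edge a b) (ℓ : Plane →ᵃ[ℝ] ℝ)
    (ha : ℓ (T.point a) = 0) (hb : ℓ (T.point b) = 0) {p : Plane} (hp : 0 < ℓ p)
    (hev : ∀ᶠ ε : ℝ in 𝓝[>] 0,
      AffineMap.lineMap (midpoint ℝ (T.point a) (T.point b)) p ε ∈ T.complex.space) :
    ∃! c, T.Tri a b c ∧ 0 < ℓ (T.point c) := by
  have hab : T.point a ≠ T.point b := T.point_injective.ne h.1
  have hm : ℓ (midpoint ℝ (T.point a) (T.point b)) = 0 := by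
    rw [AffineMap.map_midpoint, ha, hb, midpoint_self]
  obtain ⟨y, hy, -, hpos⟩ := exists_insert_mem_faces T.complex T.finite_faces
    (fun s hs ↦ subset_of_midpoint_mem_convexHull T.complex hab h.2 hs) hev
    (AffineMap.const ℝ Plane 0) ℓ (by simp) (by simp) (by simp) hm hp
  obtain ⟨c, rfl⟩ := T.exists_point_eq (T.mem_vertices_of_mem hy (Finset.mem_insert_self _ _))
  have hac : a ≠ c := by rintro rfl; exact hpos.ne' ha
  have hbc : b ≠ c := by rintro rfl; exact hpos.ne' hb
  have hface : {T.point a, T.point b, T.point c} ∈ T.complex.faces := by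
    convert! hy using 1
    ext z
    simp only [Finset.mem_insert, Finset.mem_singleton]
    tauto
  exact ⟨c, ⟨⟨h.1, hac, hbc, hface⟩, hpos⟩, fun c' hc' ↦
    T.point_injective (eq_of_same_side hc'.1.2.2.2 hface hab ℓ ha hb hc'.2 hpos)⟩

open Classical in
/-- The number of triangles that contain an edge is odd exactly for the edges on the boundary. -/
theorem natCast_card_tri {a b : Fin n} (h : T.Edge a b) :
    ((Finset.univ.filter fun c ↦ T.Tri a b c).card : ZMod 2) =
      if ∃ i, T.bary i a = 0 ∧ T.bary i b = 0 then 1 else 0 := by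
  have hab : T.point a ≠ T.point b := T.point_injective.ne h.1
  split_ifs with hi
  · obtain ⟨i, hia, hib⟩ := hi
    have hci : 0 < T.basis.coord i (T.corner i) := by
      rw [← T.coe_basis, T.basis.coord_apply_eq]; exact one_pos
    have hpm : ∀ k, T.point k ∈ T.complex.space := fun k ↦
      Geometry.SimplicialComplex.vertices_subset_space (T.point_mem_vertices k)
    obtain ⟨c, ⟨hc, -⟩, huniq⟩ := T.existsUnique_tri h (T.basis.coord i) hia hib hci
      (T.eventually_lineMap_mem_of_mem
        (T.space_eq ▸ (convex_convexHull ℝ _).midpoint_mem (T.space_eq ▸ hpm a) (T.space_eq ▸ hpm b))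
        (T.space_eq ▸ subset_convexHull ℝ _ (Set.mem_range_self i)))
    have : (Finset.univ.filter fun c ↦ T.Tri a b c) = {c} := by
      ext c'
      simp only [Finset.mem_filter, Finset.mem_univ, true_and, Finset.mem_singleton]
      refine ⟨fun hc' ↦ huniq c' ⟨hc', ?_⟩, fun h ↦ h ▸ hc⟩
      exact (T.bary_nonneg i c').lt_of_ne (ne_zero_of_mem_faces hc'.2.2.2 hab
        (T.point_injective.ne hc'.2.1) (T.point_injective.ne hc'.2.2.1) _ hia hib hci.ne').symm
    simp [this]
  · obtain ⟨ℓ, ha, hb, p, hp⟩ := exists_affineMap_vanishing hab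
    have hm : ∀ i, 0 < T.basis.coord i (midpoint ℝ (T.point a) (T.point b)) := by
      intro i
      have h1 := T.bary_nonneg i a
      have h2 := T.bary_nonneg i b
      have h3 : ¬ (T.bary i a = 0 ∧ T.bary i b = 0) := fun h ↦ hi ⟨i, h⟩
      rw [AffineMap.map_midpoint, midpoint_eq_smul_add]
      change 0 < (⅟2 : ℝ) • (T.bary i a + T.bary i b)
      have : 0 < T.bary i a + T.bary i b := by
        by_contra hcon
        exact h3 ⟨by linarith, by linarith⟩
      rw [invOf_eq_inv]
      positivity
    obtain ⟨c, ⟨hc, hcpos⟩, huniq⟩ := T.existsUnique_tri h ℓ ha hb hp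
      (T.eventually_lineMap_mem_of_pos hm p)
    -- The other side of the edge: the reflection of `p` in the point `a` satisfies `-ℓ > 0`.
    obtain ⟨c', ⟨hc', hcpos'⟩, huniq'⟩ := T.existsUnique_tri h (-ℓ) (by simp [ha]) (by simp [hb])
      (p := AffineMap.lineMap (T.point a) p (-1 : ℝ))
      (by rw [AffineMap.apply_lineMap, AffineMap.lineMap_apply]; simp [ha, hp])
      (T.eventually_lineMap_mem_of_pos hm _)
    have hne : c ≠ c' := by
      rintro rfl
      simp only [AffineMap.coe_neg, Pi.neg_apply] at hcpos'
      linarith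
    have : (Finset.univ.filter fun c ↦ T.Tri a b c) = {c, c'} := by
      ext x
      simp only [Finset.mem_filter, Finset.mem_univ, true_and, Finset.mem_singleton,
        Finset.mem_insert]
      refine ⟨fun hx ↦ ?_, ?_⟩
      · have hx0 := ne_zero_of_mem_faces hx.2.2.2 hab
          (T.point_injective.ne hx.2.1) (T.point_injective.ne hx.2.2.1) ℓ ha hb hp.ne'
        rcases hx0.lt_or_gt with hlt | hgt
        · exact Or.inr (huniq' x ⟨hx, by simpa using hlt⟩)
        · exact Or.inl (huniq x ⟨hx, hgt⟩)
      · rintro (rfl | rfl) <;> assumption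
    rw [this, Finset.card_pair hne]
    rfl

/-- Along a side of the big triangle, every vertex but the last one has exactly one successor. -/
theorem existsUnique_edge_side {i j : Fin 3} (hij : i ≠ j) {x : Fin n} (hi : T.bary i x = 0)
    (hj : T.bary j x < 1) :
    ∃! y, T.Edge x y ∧ T.bary i y = 0 ∧ T.bary j x < T.bary j y := by
  have hci : T.basis.coord i (T.corner j) = 0 := T.basis.coord_apply_ne hij
  have hcj : T.basis.coord j (T.corner j) = 1 := T.basis.coord_apply_eq j
  -- Moving from `x` towards the corner `j`; the supporting line `coord i = 0` keeps the new vertex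
  -- on the side.
  obtain ⟨y, hy, hyi, hyj⟩ := exists_insert_mem_faces T.complex T.finite_faces
    (e := {T.point x}) (m := T.point x) (p := T.corner j)
    (fun s hs hm ↦ Finset.singleton_subset_iff.2
      ((Geometry.SimplicialComplex.vertex_mem_convexHull_iff (T.point_mem_vertices x) hs).1 hm))
    (T.eventually_lineMap_mem_of_mem
      (Geometry.SimplicialComplex.vertices_subset_space (T.point_mem_vertices x))
      (T.space_eq ▸ subset_convexHull ℝ _ (Set.mem_range_self j)))
    (T.basis.coord i) (T.basis.coord j - AffineMap.const ℝ Plane (T.bary j x))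
    (fun y hy ↦ T.coord_nonneg hy i) hi hci (by simp [bary]) (by simpa [hcj] using hj)
  obtain ⟨y, rfl⟩ := T.exists_point_eq (T.mem_vertices_of_mem hy (Finset.mem_insert_self _ _))
  have hlt : T.bary j x < T.bary j y := by simpa [bary] using hyj
  refine ⟨y, ⟨⟨?_, ?_⟩, hyi, hlt⟩, ?_⟩
  · rintro rfl
    exact lt_irrefl _ hlt
  · rwa [Finset.pair_comm]
  -- Of two successors, the nearer one would lie on the edge from `x` to the farther one, but an
  -- edge contains no vertices other than its ends.
  have hpos : ∀ y y', T.Edge x y → T.bary i y = 0 → T.bary j x < T.bary j y →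
      T.Edge x y' → T.bary i y' = 0 → T.bary j y ≤ T.bary j y' → y = y' := by
    intro y y' hy hyi hyj hy' hyi' hle
    have hmem : T.point y ∈ convexHull ℝ (({T.point x, T.point y'} : Finset Plane) : Set Plane) := by
      rw [Finset.coe_pair, convexHull_pair, segment_eq_image_lineMap]
      have hden : 0 < T.bary j y' - T.bary j x := by linarith
      refine ⟨(T.bary j y - T.bary j x) / (T.bary j y' - T.bary j x),
        ⟨by apply div_nonneg <;> linarith, (div_le_one hden).2 (by linarith)⟩, ?_⟩
      refine T.eq_of_coord_eq hij ?_ ?_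
      · rw [AffineMap.apply_lineMap]
        change AffineMap.lineMap (T.bary i x) (T.bary i y') _ = T.bary i y
        rw [hi, hyi, hyi', AffineMap.lineMap_same]
        rfl
      · rw [AffineMap.apply_lineMap]
        change AffineMap.lineMap (T.bary j x) (T.bary j y') _ = T.bary j y
        rw [AffineMap.lineMap_apply, vsub_eq_sub, vadd_eq_add, smul_eq_mul,
          div_mul_cancel₀ _ hden.ne']
        ring
    rw [Geometry.SimplicialComplex.vertex_mem_convexHull_iff (T.point_mem_vertices y) hy'.2,
      Finset.mem_insert, Finset.mem_singleton] at hmem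
    rcases hmem with hmem | hmem
    · exact absurd (T.point_injective hmem) hy.1.symm
    · exact T.point_injective hmem
  rintro y' ⟨hy', hyi', hyj'⟩
  have hxy : T.Edge x y := ⟨by rintro rfl; exact lt_irrefl _ hlt, by rwa [Finset.pair_comm]⟩
  rcases le_total (T.bary j y) (T.bary j y') with hle | hle
  · exact (hpos y y' hxy hyi hlt hy' hyi' hle).symm
  · exact hpos y' y hy' hyi' hyj' hxy hyi hle

end Triangulation

end BroadcastSperner

/-! ### Parity of doors and chains of doors. -/

namespace BroadcastSperner

theorem natCast_card_eq_zero_of_involution {α : Type*} (s : Finset α) (g : α → α)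
    (hg : ∀ a ∈ s, g a ∈ s) (hgg : ∀ a ∈ s, g (g a) = a) (hne : ∀ a ∈ s, g a ≠ a) :
    (s.card : ZMod 2) = 0 := by
  rw [Finset.cast_card]
  exact Finset.sum_involution (fun a _ ↦ g a) (fun _ _ ↦ CharTwo.add_self_eq_zero 1)
    (fun a ha _ ↦ hne a ha) hg hgg

namespace Triangulation

variable {n : ℕ} (T : Triangulation n)

-- A vertex on the side has one neighbor in each direction, except that the corner `v₀` lacks one;
-- the other corner is excluded by `h0`.
open Classical in
theorem natCast_card_edge_side {x : Fin n} (h2 : T.bary 2 x = 0) (h0 : T.bary 0 x ≠ 0) :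
    ((Finset.univ.filter fun y ↦ T.Edge x y ∧ T.bary 2 y = 0).card : ZMod 2) =
      if T.bary 0 x = 1 then 1 else 0 := by
  have hsx := T.bary_sum x
  have h0' := (T.bary_nonneg 0 x).lt_of_ne h0.symm
  obtain ⟨r, ⟨hr, hr2, hr1⟩, hur⟩ := T.existsUnique_edge_side (i := 2) (j := 1) (by decide) h2
    (by linarith)
  have hright : ∀ y, T.Edge x y → T.bary 2 y = 0 → T.bary 1 x < T.bary 1 y → y = r :=
    fun y h h' h'' ↦ hur y ⟨h, h', h''⟩
  have hcase : ∀ y, T.Edge x y → T.bary 2 y = 0 →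
      T.bary 1 x < T.bary 1 y ∨ T.bary 0 x < T.bary 0 y := by
    intro y hy hy2
    have hsy := T.bary_sum y
    by_contra! hcon
    refine hy.1 (T.point_injective (T.eq_of_coord_eq (i := 0) (j := 1) (by decide) ?_ ?_))
    · change T.bary 0 x = T.bary 0 y
      linarith
    · change T.bary 1 x = T.bary 1 y
      linarith
  split_ifs with h1
  · have : (Finset.univ.filter fun y ↦ T.Edge x y ∧ T.bary 2 y = 0) = {r} := by
      ext y
      simp only [Finset.mem_filter, Finset.mem_univ, true_and, Finset.mem_singleton]
      refine ⟨fun hy ↦ hright y hy.1 hy.2 ?_, fun h ↦ h ▸ ⟨hr, hr2⟩⟩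
      refine (hcase y hy.1 hy.2).resolve_right fun hlt ↦ ?_
      linarith [T.bary_sum y, T.bary_nonneg 1 y]
    simp [this]
  · obtain ⟨l, ⟨hl, hl2, hl0⟩, hul⟩ := T.existsUnique_edge_side (i := 2) (j := 0) (by decide) h2
      (lt_of_le_of_ne (by linarith [T.bary_nonneg 1 x]) h1)
    have hrl : r ≠ l := by
      rintro rfl
      linarith [T.bary_sum r]
    have : (Finset.univ.filter fun y ↦ T.Edge x y ∧ T.bary 2 y = 0) = {r, l} := by
      ext y
      simp only [Finset.mem_filter, Finset.mem_univ, true_and, Finset.mem_singleton,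
        Finset.mem_insert]
      refine ⟨fun hy ↦ ?_, ?_⟩
      · exact (hcase y hy.1 hy.2).imp (hright y hy.1 hy.2) fun h ↦ hul y ⟨hy.1, hy.2, h⟩
      · rintro (rfl | rfl)
        exacts [⟨hr, hr2⟩, ⟨hl, hl2⟩]
    rw [this, Finset.card_pair hrl]
    rfl

/-- A door of `A` is an edge, directed from a vertex in `A` to a vertex outside `A`. -/
def Door (A : Finset (Fin n)) (d : Fin n × Fin n) : Prop :=
  d.1 ∈ A ∧ d.2 ∉ A ∧ T.Edge d.1 d.2

/-- The edge `d` lies on the side of the big triangle opposite to the corner `i`. -/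
def OnSide (i : Fin 3) (d : Fin n × Fin n) : Prop := T.bary i d.1 = 0 ∧ T.bary i d.2 = 0

open Classical in
/-- The number of doors on a side from a corner in `A` to a corner not in `A` is odd. -/
theorem natCast_card_door_side {A : Finset (Fin n)} (hA : ∀ k ∈ A, T.bary 0 k ≠ 0)
    (hcorner : ∀ k, T.bary 0 k = 1 → k ∈ A) :
    ((Finset.univ.filter fun d ↦ T.Door A d ∧ T.OnSide 2 d).card : ZMod 2) = 1 := by
  -- Edges with both ends in `A` are counted in both directions, hence cancel modulo 2.
  have hinner : ((Finset.univ.filter fun d : Fin n × Fin n ↦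
      d.1 ∈ A ∧ d.2 ∈ A ∧ T.Edge d.1 d.2 ∧ T.OnSide 2 d).card : ZMod 2) = 0 := by
    refine natCast_card_eq_zero_of_involution _ Prod.swap ?_ (fun _ _ ↦ Prod.swap_swap _) ?_
    · simp only [Finset.mem_filter, Finset.mem_univ, true_and]
      exact fun d hd ↦ ⟨hd.2.1, hd.1, hd.2.2.1.symm, hd.2.2.2.2, hd.2.2.2.1⟩
    · simp only [Finset.mem_filter, Finset.mem_univ, true_and]
      exact fun d hd h ↦ hd.2.2.1.1 (congrArg Prod.snd h)
  obtain ⟨v, hv⟩ := T.exists_corner 0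
  have hv0 : T.bary 0 v = 1 := by
    rw [bary, hv]; exact T.basis.coord_apply_eq 0
  have hv2 : T.bary 2 v = 0 := by
    rw [bary, hv]; exact T.basis.coord_apply_ne (by decide)
  have htotal : ((Finset.univ.filter fun d : Fin n × Fin n ↦
      d.1 ∈ A ∧ T.Edge d.1 d.2 ∧ T.OnSide 2 d).card : ZMod 2) = 1 := by
    have hx : ∀ x, (∑ y, if x ∈ A ∧ T.Edge x y ∧ T.OnSide 2 (x, y) then (1 : ZMod 2) else 0) =
        if x = v then 1 else 0 := by
      intro x
      rw [← Finset.natCast_card_filter]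
      by_cases hxA : x ∈ A ∧ T.bary 2 x = 0
      · have : (Finset.univ.filter fun y ↦ x ∈ A ∧ T.Edge x y ∧ T.OnSide 2 (x, y)) =
            Finset.univ.filter fun y ↦ T.Edge x y ∧ T.bary 2 y = 0 := by
          ext y
          simp [OnSide, hxA.1, hxA.2]
        rw [this, T.natCast_card_edge_side hxA.2 (hA x hxA.1)]
        have hiff : T.bary 0 x = 1 ↔ x = v := by
          refine ⟨fun h ↦ T.point_injective ?_, fun h ↦ h ▸ hv0⟩
          exact T.eq_of_coord_eq (i := 0) (j := 2) (by decide) (h.trans hv0.symm)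
            (hxA.2.trans hv2.symm)
        simp only [hiff]
      · have hxv : x ≠ v := by
          rintro rfl
          exact hxA ⟨hcorner x hv0, hv2⟩
        rw [if_neg hxv, Finset.filter_false_of_mem]
        · simp
        · exact fun y _ h ↦ hxA ⟨h.1, h.2.2.1⟩
    rw [Finset.natCast_card_filter, Fintype.sum_prod_type]
    simp only [hx, Finset.sum_ite_eq', Finset.mem_univ, if_true]
  have hunion : (Finset.univ.filter fun d : Fin n × Fin n ↦
      d.1 ∈ A ∧ T.Edge d.1 d.2 ∧ T.OnSide 2 d) =
      (Finset.univ.filter fun d ↦ T.Door A d ∧ T.OnSide 2 d) ∪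
      Finset.univ.filter fun d : Fin n × Fin n ↦
        d.1 ∈ A ∧ d.2 ∈ A ∧ T.Edge d.1 d.2 ∧ T.OnSide 2 d := by
    ext d
    simp only [Finset.mem_union, Finset.mem_filter, Finset.mem_univ, true_and, Door]
    by_cases hd : d.2 ∈ A <;> simp [hd, and_assoc]
  have hdisj : Disjoint (Finset.univ.filter fun d ↦ T.Door A d ∧ T.OnSide 2 d)
      (Finset.univ.filter fun d : Fin n × Fin n ↦
        d.1 ∈ A ∧ d.2 ∈ A ∧ T.Edge d.1 d.2 ∧ T.OnSide 2 d) :=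
    Finset.disjoint_filter.2 fun d _ h h' ↦ h.1.2.1 h'.2.1
  rw [hunion, Finset.card_union_of_disjoint hdisj, Nat.cast_add, hinner, add_zero] at htotal
  exact htotal

/-- Two doors are adjacent if they are edges of the same triangle. -/
def doorGraph (A : Finset (Fin n)) : SimpleGraph (Fin n × Fin n) where
  Adj d d' := T.Door A d ∧ T.Door A d' ∧
    (d.1 = d'.1 ∧ T.Tri d.1 d.2 d'.2 ∨ d.2 = d'.2 ∧ T.Tri d.1 d.2 d'.1)
  symm := ⟨by
    rintro ⟨a, b⟩ ⟨a', b'⟩ ⟨hd, hd', h⟩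
    refine ⟨hd', hd, h.imp ?_ ?_⟩
    · rintro ⟨rfl, h⟩
      exact ⟨rfl, h.swap_right⟩
    · rintro ⟨rfl, h⟩
      exact ⟨rfl, h.swap_right.swap_left.swap_right⟩⟩
  loopless := ⟨by
    rintro ⟨a, b⟩ ⟨-, -, ⟨-, h⟩ | ⟨-, h⟩⟩
    exacts [h.2.2.1 rfl, h.2.1 rfl]⟩

/-- Some door on one side is connected to a door on the other side. -/
theorem exists_reachable_door {A : Finset (Fin n)} (hA : ∀ k ∈ A, T.bary 0 k ≠ 0)
    (hcorner : ∀ k, T.bary 0 k = 1 → k ∈ A) :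
    ∃ d d', T.Door A d ∧ T.OnSide 2 d ∧ T.OnSide 1 d' ∧ (T.doorGraph A).Reachable d d' := by
  classical
  by_contra! hcon
  set S : Finset (Fin n × Fin n) := Finset.univ.filter fun d ↦ T.Door A d ∧
    ∃ d₀, T.Door A d₀ ∧ T.OnSide 2 d₀ ∧ (T.doorGraph A).Reachable d₀ d with hS
  have hmemS : ∀ d, d ∈ S ↔ T.Door A d ∧
    ∃ d₀, T.Door A d₀ ∧ T.OnSide 2 d₀ ∧ (T.doorGraph A).Reachable d₀ d := fun d ↦ by simp [hS]
  have hclosed : ∀ d ∈ S, ∀ d', (T.doorGraph A).Adj d d' → d' ∈ S := by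
    intro d hd d' hadj
    obtain ⟨-, d₀, h1, h2, h3⟩ := (hmemS d).1 hd
    exact (hmemS d').2 ⟨hadj.2.1, d₀, h1, h2, h3.trans hadj.reachable⟩
  -- `P` consists of the pairs of a reachable door and a triangle on it, encoded by the third
  -- vertex. It is counted modulo 2 by triangles and by doors.
  set P : Finset ((Fin n × Fin n) × Fin n) :=
    Finset.univ.filter fun p ↦ p.1 ∈ S ∧ T.Tri p.1.1 p.1.2 p.2 with hP
  have hP0 : (P.card : ZMod 2) = 0 := by
    refine natCast_card_eq_zero_of_involution P
      -- Keep the triangle and pass to its other door, determined by whether the third vertex is in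
      -- `A`.
      (fun p ↦ if p.2 ∈ A then ((p.2, p.1.2), p.1.1) else ((p.1.1, p.2), p.1.2)) ?_ ?_ ?_
    · rintro ⟨⟨a, b⟩, c⟩ hp
      simp only [hP, Finset.mem_filter, Finset.mem_univ, true_and] at hp ⊢
      obtain ⟨hd, htri⟩ := hp
      have hdoor := ((hmemS _).1 hd).1
      split_ifs with hc
      · have h' := htri.swap_right.swap_left.swap_right
        exact ⟨hclosed _ hd _ ⟨hdoor, ⟨hc, hdoor.2.1, h'.edge⟩, Or.inr ⟨rfl, htri⟩⟩, h'⟩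
      · have h' := htri.swap_right
        exact ⟨hclosed _ hd _ ⟨hdoor, ⟨hdoor.1, hc, h'.edge⟩, Or.inl ⟨rfl, htri⟩⟩, h'⟩
    · rintro ⟨⟨a, b⟩, c⟩ hp
      simp only [hP, Finset.mem_filter, Finset.mem_univ, true_and] at hp
      have hdoor := ((hmemS _).1 hp.1).1
      have ha : a ∈ A := hdoor.1
      have hb : b ∉ A := hdoor.2.1
      by_cases hc : c ∈ A <;> simp [hc, ha, hb]
    · rintro ⟨⟨a, b⟩, c⟩ hp
      simp only [hP, Finset.mem_filter, Finset.mem_univ, true_and] at hp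
      have hac : a ≠ c := hp.2.2.1
      have hbc : b ≠ c := hp.2.2.2.1
      split_ifs <;> simp [hac, hbc]
  -- Only boundary doors contribute. Those in `S` lie opposite to `v₂`: `hA` excludes the side
  -- opposite to `v₀`, and `hcon` the one opposite to `v₁`.
  have hP1 : (P.card : ZMod 2) = 1 := by
    have hd : ∀ d, (∑ c, if d ∈ S ∧ T.Tri d.1 d.2 c then (1 : ZMod 2) else 0) =
        if T.Door A d ∧ T.OnSide 2 d then 1 else 0 := by
      intro d
      rw [← Finset.natCast_card_filter]
      by_cases hdS : d ∈ S
      · obtain ⟨hdoor, d₀, h1, h2, h3⟩ := (hmemS d).1 hdS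
        have hiff : (∃ i, T.bary i d.1 = 0 ∧ T.bary i d.2 = 0) ↔
            T.Door A d ∧ T.OnSide 2 d := by
          refine ⟨?_, fun h ↦ ⟨2, h.2⟩⟩
          rintro ⟨i, hi⟩
          fin_cases i
          · exact absurd hi.1 (hA _ hdoor.1)
          · exact absurd h3 (hcon d₀ d h1 h2 hi)
          · exact ⟨hdoor, hi⟩
        simp only [hdS, true_and]
        rw [T.natCast_card_tri hdoor.2.2]
        simp only [hiff]
      · rw [if_neg fun h ↦ hdS ((hmemS d).2 ⟨h.1, d, h.1, h.2, SimpleGraph.Reachable.refl d⟩)]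
        simp [hdS]
    rw [hP, Finset.natCast_card_filter, Fintype.sum_prod_type]
    simp only [hd]
    rw [← Finset.natCast_card_filter, T.natCast_card_door_side hA hcorner]
  exact zero_ne_one (hP0.symm.trans hP1)

/-- A chain of doors from one side to another one, of polynomial length. -/
theorem exists_chain {A : Finset (Fin n)} (hA : ∀ k ∈ A, T.bary 0 k ≠ 0)
    (hcorner : ∀ k, T.bary 0 k = 1 → k ∈ A) :
    ∃ f : ℕ → Fin n × Fin n, (∀ j, T.Door A (f j)) ∧ T.OnSide 2 (f 0) ∧
      (∀ N, n * n ≤ N → T.OnSide 1 (f N)) ∧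
      ∀ j, f j = f (j + 1) ∨ (T.doorGraph A).Adj (f j) (f (j + 1)) := by
  obtain ⟨d, d', hd, h2, h1, hr⟩ := T.exists_reachable_door hA hcorner
  obtain ⟨p, hp⟩ := hr.exists_isPath
  have hlen := hp.length_lt
  rw [Fintype.card_prod, Fintype.card_fin] at hlen
  have hstep : ∀ j, p.getVert j = p.getVert (j + 1) ∨
      (T.doorGraph A).Adj (p.getVert j) (p.getVert (j + 1)) := by
    intro j
    rcases lt_or_ge j p.length with hj | hj
    · exact Or.inr (p.adj_getVert_succ hj)
    · left
      rw [p.getVert_of_length_le hj, p.getVert_of_length_le (by omega)]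
  -- `getVert` stays at the last door beyond the end of the path, which allows the chain to be
  -- padded to any length.
  refine ⟨p.getVert, fun j ↦ ?_, by simpa using h2, fun N hN ↦ ?_, hstep⟩
  · induction j with
    | zero => simpa using hd
    | succ j ih =>
      rcases hstep j with h | h
      · exact h ▸ ih
      · exact h.2.1
  · rw [p.getVert_of_length_le (by omega)]
    exact h1

end Triangulation

end BroadcastSperner

/-! ### Protocols and binary search. -/

namespace BroadcastSperner

section Solvable

variable {ι : Type} {X : ι → Type} {Z : Type}

/-- Some protocol of cost at most `c` produces an output related by `R` to the inputs, for all
inputs in `G`. -/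
def Solvable (R : (∀ p, X p) → Z → Prop) (G : Set (∀ p, X p)) (c : ℕ) : Prop :=
  ∃ P : Protocol X Z, P.cost ≤ c ∧ ∀ x ∈ G, R x (P.run x)

variable {R : (∀ p, X p) → Z → Prop} {G G' : Set (∀ p, X p)} {c c' : ℕ}

theorem Solvable.mono (h : Solvable R G c) (hG : G' ⊆ G) (hc : c ≤ c') : Solvable R G' c' := by
  obtain ⟨P, hP, hR⟩ := h
  exact ⟨P, hP.trans hc, fun x hx ↦ hR x (hG hx)⟩

theorem solvable_output (z : Z) (h : ∀ x ∈ G, R x z) : Solvable R G c :=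
  ⟨.output z, Nat.zero_le _, h⟩

open Classical in
/-- A player broadcasts whether its input has the property `Q`. -/
theorem solvable_speak (p : ι) (Q : X p → Prop) (h₁ : Solvable R {x ∈ G | Q (x p)} c)
    (h₀ : Solvable R {x ∈ G | ¬ Q (x p)} c) : Solvable R G (c + 1) := by
  obtain ⟨P₁, hP₁, hR₁⟩ := h₁
  obtain ⟨P₀, hP₀, hR₀⟩ := h₀
  refine ⟨.speak p (fun y ↦ decide (Q y)) P₀ P₁, ?_, fun x hx ↦ ?_⟩
  · rw [Protocol.cost, add_comm]
    exact Nat.add_le_add_right (max_le hP₀ hP₁) 1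
  · by_cases hQ : Q (x p)
    · simpa [Protocol.run, hQ] using hR₁ x ⟨hx, hQ⟩
    · simpa [Protocol.run, hQ] using hR₀ x ⟨hx, hQ⟩

/-- A player broadcasts a number of `k` bits. -/
theorem solvable_announce (p : ι) (k : ℕ) (g : X p → ℕ) (hg : ∀ x ∈ G, g (x p) < 2 ^ k)
    (h : ∀ v, Solvable R {x ∈ G | g (x p) = v} c) : Solvable R G (c + k) := by
  induction k generalizing G g with
  | zero => exact (h 0).mono (fun x hx ↦ ⟨hx, by simpa using hg x hx⟩) le_rfl
  | succ k ih =>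
    -- The lowest bit is sent first, then the half of the number.
    refine solvable_speak p (fun y ↦ g y % 2 = 1) ?_ ?_
    · refine ih (fun y ↦ g y / 2) (fun x hx ↦ ?_) fun v ↦ (h (2 * v + 1)).mono ?_ le_rfl
      · have := hg x hx.1
        rw [pow_succ] at this
        omega
      · rintro x ⟨⟨hx, h1⟩, h2⟩
        exact ⟨hx, by omega⟩
    · refine ih (fun y ↦ g y / 2) (fun x hx ↦ ?_) fun v ↦ (h (2 * v)).mono ?_ le_rfl
      · have := hg x hx.1
        rw [pow_succ] at this
        omega
      · rintro x ⟨⟨hx, h1⟩, h2⟩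
        exact ⟨hx, by omega⟩

theorem solvable_announce_fin {n k : ℕ} [Nonempty (Fin n)] (hn : n ≤ 2 ^ k) (p : ι)
    (g : X p → Fin n) (h : ∀ v, Solvable R {x ∈ G | g (x p) = v} c) : Solvable R G (c + k) := by
  refine solvable_announce p k (fun y ↦ g y) (fun x _ ↦ (g (x p)).2.trans_le hn) fun v ↦ ?_
  by_cases hv : v < n
  · exact (h ⟨v, hv⟩).mono (fun x hx ↦ ⟨hx.1, Fin.ext hx.2⟩) le_rfl
  · refine (h (Classical.arbitrary _)).mono (fun x hx ↦ ?_) le_rfl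
    exact absurd (hx.2 ▸ (g (x p)).2) hv

end Solvable

variable {n : ℕ}

/-- The vertex `v`, which is not in the first class, is queried for its color. -/
theorem solvable_query (T : Triangulation n) {G : Set (∀ _ : Fin 3, Finset (Fin n))} {c : ℕ}
    (v : Fin n) (hv : ∀ C ∈ G, v ∉ C 0)
    (h₁ : Solvable (fun C ↦ Answer.IsCorrect T C) {C ∈ G | v ∈ C 1} c)
    (h₂ : Solvable (fun C ↦ Answer.IsCorrect T C) {C ∈ G | v ∈ C 2} c) :
    Solvable (fun C ↦ Answer.IsCorrect T C) G (c + 2) := by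
  refine solvable_speak (1 : Fin 3) (fun D : Finset (Fin n) ↦ v ∈ D)
    (h₁.mono subset_rfl (Nat.le_succ c)) ?_
  refine solvable_speak (2 : Fin 3) (fun D : Finset (Fin n) ↦ v ∈ D)
    (h₂.mono (fun C hC ↦ ⟨hC.1.1, hC.2⟩) le_rfl) ?_
  refine solvable_output (.notPartition v) ?_
  rintro C ⟨⟨hC, h1⟩, h2⟩ ⟨i, hi, -⟩
  fin_cases i
  exacts [hv C hC hi, h1 hi, h2 hi]

/-- A chain of doors from the side opposite to `v₂` to the side opposite to `v₁`. -/
structure IsChain (T : Triangulation n) (A : Finset (Fin n)) (N : ℕ) (f : ℕ → Fin n × Fin n) :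
    Prop where
  door : ∀ j, T.Door A (f j)
  start : T.OnSide 2 (f 0)
  finish : T.OnSide 1 (f N)
  step : ∀ j, f j = f (j + 1) ∨ (T.doorGraph A).Adj (f j) (f (j + 1))

/-- Two consecutive doors of a chain whose outer ends have the colors `1` and `2` yield a
panchromatic triangle. -/
theorem isTriangle_of_isChain {T : Triangulation n} {A : Finset (Fin n)} {N : ℕ}
    {f : ℕ → Fin n × Fin n} (hf : IsChain T A N f) {j : ℕ} (hne : (f j).2 ≠ (f (j + 1)).2) :
    T.IsTriangle ![(f j).1, (f j).2, (f (j + 1)).2] := by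
  have htri : T.Tri (f j).1 (f j).2 (f (j + 1)).2 := by
    rcases hf.step j with h | ⟨-, -, ⟨-, h⟩ | ⟨h, -⟩⟩
    · exact absurd (congrArg Prod.snd h) hne
    · exact h
    · exact absurd h hne
  obtain ⟨hab, hac, hbc, hface⟩ := htri
  refine ⟨fun i j hij ↦ ?_, ?_⟩
  · fin_cases i <;> fin_cases j <;> simp_all
  · convert! hface using 1
    ext x
    simp only [Finset.mem_image, Finset.mem_univ, true_and, Finset.mem_insert,
      Finset.mem_singleton, Fin.exists_fin_succ]
    simp [eq_comm]

/-- Binary search along a chain of doors. -/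
theorem solvable_search (T : Triangulation n) {L N : ℕ} [Nonempty (Fin n)] (hn : n ≤ 2 ^ L)
    (f : Finset (Fin n) → ℕ → Fin n × Fin n) (k lo : ℕ) :
    Solvable (fun C ↦ Answer.IsCorrect T C)
      {C : ∀ _ : Fin 3, Finset (Fin n) | IsChain T (C 0) N (f (C 0)) ∧ (f (C 0) lo).2 ∈ C 1 ∧
        (f (C 0) (lo + 2 ^ k)).2 ∈ C 2} (k * (L + 2) + 3 * L) := by
  induction k generalizing lo with
  | zero =>
    rw [show 0 * (L + 2) + 3 * L = 0 + L + L + L by ring]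
    refine solvable_announce_fin hn (0 : Fin 3) (fun A : Finset (Fin n) ↦ (f A lo).1) fun a ↦ ?_
    refine solvable_announce_fin hn (0 : Fin 3) (fun A : Finset (Fin n) ↦ (f A lo).2) fun b ↦ ?_
    refine solvable_announce_fin hn (0 : Fin 3)
      (fun A : Finset (Fin n) ↦ (f A (lo + 1)).2) fun b' ↦ ?_
    by_cases hb : b = b'
    -- The same vertex ends both doors, so it lies in both `C 1` and `C 2`.
    · refine solvable_output (.notPartition b) ?_
      rintro C ⟨⟨⟨⟨-, h1, h2⟩, -⟩, h4⟩, h5⟩ ⟨i, -, hi⟩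
      have e1 := hi 1 (h4 ▸ h1)
      have e2 := hi 2 (by rw [hb]; exact h5 ▸ h2)
      exact absurd (e1.trans e2.symm) (by decide)
    · refine solvable_output (.panchromatic ![a, b, b']) ?_
      rintro C ⟨⟨⟨⟨hf, h1, h2⟩, rfl⟩, rfl⟩, rfl⟩
      refine ⟨fun i ↦ ?_, isTriangle_of_isChain hf hb⟩
      fin_cases i
      exacts [(hf.door lo).1, h1, h2]
  | succ k ih =>
    rw [show (k + 1) * (L + 2) + 3 * L = k * (L + 2) + 3 * L + 2 + L by ring]
    refine solvable_announce_fin hn (0 : Fin 3)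
      (fun A : Finset (Fin n) ↦ (f A (lo + 2 ^ k)).2) fun v ↦ ?_
    -- Color 1 at the middle door leaves the second half of the chain, color 2 the first half.
    refine solvable_query T v ?_ ((ih (lo + 2 ^ k)).mono ?_ le_rfl) ((ih lo).mono ?_ le_rfl)
    · rintro C ⟨⟨hf, -⟩, rfl⟩
      exact (hf.door _).2.1
    · rintro C ⟨⟨⟨hf, h1, h2⟩, rfl⟩, hv⟩
      refine ⟨hf, hv, ?_⟩
      rwa [add_assoc, ← two_mul, ← pow_succ']
    · rintro C ⟨⟨⟨hf, h1, h2⟩, rfl⟩, hv⟩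
      exact ⟨hf, h1, hv⟩

/-- The outer ends of the first and last door are queried: wrong colors there violate the boundary
condition, the right ones start the binary search. -/
theorem solvable_chain (T : Triangulation n) {L k : ℕ} [Nonempty (Fin n)] (hn : n ≤ 2 ^ L)
    (f : Finset (Fin n) → ℕ → Fin n × Fin n) :
    Solvable (fun C ↦ Answer.IsCorrect T C)
      {C : ∀ _ : Fin 3, Finset (Fin n) | IsChain T (C 0) (2 ^ k) (f (C 0))}
      (k * (L + 2) + 3 * L + 2 + L + 2 + L) := by
  refine solvable_announce_fin hn (0 : Fin 3) (fun A : Finset (Fin n) ↦ (f A 0).2) fun v ↦ ?_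
  refine solvable_query T v ?_ ?_ (solvable_output (.notSperner v) ?_)
  · rintro C ⟨hf, rfl⟩
    exact (hf.door 0).2.1
  · refine solvable_announce_fin hn (0 : Fin 3)
      (fun A : Finset (Fin n) ↦ (f A (2 ^ k)).2) fun w ↦ ?_
    refine solvable_query T w ?_ (solvable_output (.notSperner w) ?_)
      ((solvable_search T (N := 2 ^ k) hn f k 0).mono ?_ le_rfl)
    · rintro C ⟨⟨⟨hf, rfl⟩, -⟩, rfl⟩
      exact (hf.door _).2.1
    · rintro C ⟨⟨⟨⟨hf, rfl⟩, -⟩, rfl⟩, hw⟩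
      exact ⟨1, hw, T.notMem_carrier hf.finish.2⟩
    · rintro C ⟨⟨⟨⟨hf, rfl⟩, hv⟩, rfl⟩, hw⟩
      exact ⟨hf, hv, by rwa [zero_add]⟩
  · rintro C ⟨⟨hf, rfl⟩, hv⟩
    exact ⟨2, hv, T.notMem_carrier hf.start.2⟩

/-- Player 0's two initial bits settle whether `C 0` satisfies the conditions under which a chain
exists; the cost is theirs plus that of `solvable_chain` with `k = 2 * L`, as `n² ≤ 2 ^ (2 * L)`. -/
theorem solvable_univ (T : Triangulation n) {L : ℕ} (hn : n ≤ 2 ^ L) :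
    Solvable (fun C ↦ Answer.IsCorrect T C) Set.univ (2 * L * (L + 2) + 5 * L + 6) := by
  classical
  obtain ⟨v, hv⟩ := T.exists_corner 0
  have : Nonempty (Fin n) := ⟨v⟩
  have hv0 : T.bary 0 v = 1 := by
    rw [Triangulation.bary, hv]; exact T.basis.coord_apply_eq 0
  have hvne : ∀ i : Fin 3, i ≠ 0 → T.bary i v = 0 := fun i hi ↦ by
    rw [Triangulation.bary, hv]; exact T.basis.coord_apply_ne hi
  have hchain : ∀ A : Finset (Fin n), ∃ f, (∀ k ∈ A, T.bary 0 k ≠ 0) → v ∈ A →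
      IsChain T A (2 ^ (2 * L)) f := by
    intro A
    by_cases hA : (∀ k ∈ A, T.bary 0 k ≠ 0) ∧ v ∈ A
    · obtain ⟨f, h1, h2, h3, h4⟩ := T.exists_chain hA.1 fun k hk ↦ by
        have hsum := T.bary_sum k
        have h1 := T.bary_nonneg 1 k
        have h2 := T.bary_nonneg 2 k
        have : k = v := T.point_injective (T.eq_of_coord_eq (i := 0) (j := 1) (by decide)
          (hk.trans hv0.symm) ((by linarith : T.bary 1 k = 0).trans (hvne 1 (by decide)).symm))
        exact this ▸ hA.2
      refine ⟨f, fun _ _ ↦ ⟨h1, h2, h3 _ ?_, h4⟩⟩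
      rw [two_mul, pow_add]
      exact Nat.mul_le_mul hn hn
    -- A dummy value: the chain is used only after both conditions have been tested.
    · exact ⟨fun _ ↦ (v, v), fun h h' ↦ absurd ⟨h, h'⟩ hA⟩
  choose f hf using hchain
  refine solvable_speak (0 : Fin 3)
    (fun A : Finset (Fin n) ↦ ∃ k ∈ A, T.bary 0 k = 0) ?_ ?_
  · have hg : ∀ A : Finset (Fin n), ∃ k, (∃ k ∈ A, T.bary 0 k = 0) → k ∈ A ∧ T.bary 0 k = 0 := by
      intro A
      by_cases h : ∃ k ∈ A, T.bary 0 k = 0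
      · exact h.imp fun k hk _ ↦ hk
      · exact ⟨v, fun h' ↦ absurd h' h⟩
    choose g hg using hg
    refine (solvable_announce_fin (c := 0) hn (0 : Fin 3) g fun k ↦ ?_).mono subset_rfl
      (by nlinarith)
    refine solvable_output (.notSperner k) ?_
    rintro C ⟨⟨-, h⟩, rfl⟩
    exact ⟨0, (hg _ h).1, T.notMem_carrier (hg _ h).2⟩
  · refine solvable_speak (0 : Fin 3) (fun A : Finset (Fin n) ↦ v ∈ A) ?_ ?_
    · refine (solvable_chain T (k := 2 * L) hn f).mono ?_ (by nlinarith)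
      rintro C ⟨⟨-, h⟩, h'⟩
      exact hf _ (fun k hk h0 ↦ h ⟨k, hk, h0⟩) h'
    · refine (solvable_query (c := 0) T v (fun C hC ↦ hC.2)
        (solvable_output (.notSperner v) ?_)
        (solvable_output (.notSperner v) ?_)).mono subset_rfl (by omega)
      · exact fun C hC ↦ ⟨1, hC.2, T.notMem_carrier (hvne 1 (by decide))⟩
      · exact fun C hC ↦ ⟨2, hC.2, T.notMem_carrier (hvne 2 (by decide))⟩

theorem two_le_of_triangulation (T : Triangulation n) : 2 ≤ n := by
  obtain ⟨v, hv⟩ := T.exists_corner 0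
  obtain ⟨w, hw⟩ := T.exists_corner 1
  have hne : (v : ℕ) ≠ w := fun h ↦ by
    have := T.corner_indep.injective (hv.symm.trans ((congrArg T.point (Fin.ext h)).trans hw))
    exact absurd this (by decide)
  omega

end BroadcastSperner

theorem mainTheorem8 :
    ∃ c : ℝ, ∀ (n : ℕ) (T : BroadcastSperner.Triangulation n),
      ∃ P : BroadcastSperner.Protocol (fun _ : Fin 3 => Finset (Fin n))
          (BroadcastSperner.Answer n),
        (P.cost : ℝ) ≤ c * Real.log n ^ 2 ∧
          ∀ C : Fin 3 → Finset (Fin n), (P.run C).IsCorrect T C := by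
  -- For `L ≥ 1` the cost `2L² + 9L + 6` is at most `17L²`. Moreover `L - 1 ≤ log₂ n` and `1 ≤ log₂
  -- n` give `L ≤ 2 log₂ n`.
  refine ⟨17 * (2 / Real.log 2) ^ 2, fun n T ↦ ?_⟩
  have hn : 2 ≤ n := BroadcastSperner.two_le_of_triangulation T
  set L := Nat.clog 2 n with hL
  obtain ⟨P, hP, hR⟩ := BroadcastSperner.solvable_univ T (Nat.le_pow_clog one_lt_two n)
  rw [← hL] at hP
  refine ⟨P, ?_, fun C ↦ hR C (Set.mem_univ C)⟩
  have hL1 : 1 ≤ L := Nat.clog_pos one_lt_two hn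
  have hcost : (P.cost : ℝ) ≤ 17 * (L : ℝ) ^ 2 := by
    have : P.cost ≤ 17 * L ^ 2 := by nlinarith
    exact_mod_cast this
  have hlog2 : 0 < Real.log 2 := Real.log_pos one_lt_two
  have hlogn : Real.log 2 ≤ Real.log n :=
    Real.log_le_log two_pos (by exact_mod_cast hn)
  have hLn : (L : ℝ) ≤ 2 / Real.log 2 * Real.log n := by
    have hlt : 2 ^ (L - 1) < n := Nat.pow_pred_clog_lt_self one_lt_two hn
    have h1 : ((L - 1 : ℕ) : ℝ) * Real.log 2 ≤ Real.log n := by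
      rw [← Real.log_pow]
      exact Real.log_le_log (by positivity) (by exact_mod_cast hlt.le)
    rw [Nat.cast_sub hL1, Nat.cast_one] at h1
    rw [div_mul_eq_mul_div, le_div_iff₀ hlog2]
    linarith
  calc (P.cost : ℝ) ≤ 17 * (L : ℝ) ^ 2 := hcost
    _ ≤ 17 * (2 / Real.log 2 * Real.log n) ^ 2 := by gcongr
    _ = _ := by ring
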